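/- Let $K \subset \mathbb{R}^2$ be a compact connected set with $\mathcal{H}^1(K) < \infty$, where $\mathcal{H}^1$ denotes the one-dimensional Hausdorff measure on the Euclidean plane. Let $C$ be the convex hull of $K$, and let $\partial C$ be its topological boundary in $\mathbb{R}^2$. Then $$\mathcal{H}^1(\partial C) \le 2\,\mathcal{H}^1(K).$$ -/

import Mathlib

open scoped MeasureTheory

/-!
Suppose first that the convex hull is a polygon with vertices in `K`. An oriented line crosses the
boundary of a convex set upwards at most once, so the sets of lines crossing the different edges
upwards are disjoint. Each has kinematic measure half the length of its edge, by Crofton's formula,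
so half the perimeter is at most the measure of the lines separating some vertices. Sorting these
lines by which vertices lie above them gives a weighting of the cuts of the vertex set for which the
cuts separating two vertices weigh at most their distance. Uncrossing makes such a packing of cuts
laminar without changing its total weight, and the cuts of a laminar packing are realised by
disjoint moats around groups of vertices, each of which `K` has to cross. Hence the total weight is
at most the length of `K`.

In general, `K` lies in homothetic copies, with ratio tending to `1`, of the convex hulls of
finitely many of its points. The length of the boundary is monotone for convex sets, because the
nearest-point projection maps the boundary of the larger set onto that of the smaller one and does
not increase distances.
-/

open MeasureTheory Metric Module Set Filter
open scoped ENNReal NNReal Pointwise RealInnerProductSpace symmDiff Topology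

section Preconnected

variable {X : Type*} [MetricSpace X] [MeasurableSpace X] [BorelSpace X] {K : Set X}

theorem ofReal_sub_le_hausdorffMeasure_inter_preimage_Ioo (hK : IsPreconnected K) {f : X → ℝ}
    (hf : LipschitzWith 1 f) {a b : X} (ha : a ∈ K) (hb : b ∈ K) {s t : ℝ} (hs : f a ≤ s)
    (ht : t ≤ f b) : ENNReal.ofReal (t - s) ≤ μH[1] (K ∩ f ⁻¹' Ioo s t) := by
  have hsub : Ioo s t ⊆ f '' (K ∩ f ⁻¹' Ioo s t) := by
    rw [image_inter_preimage]
    exact subset_inter (Ioo_subset_Icc_self.trans <| (Icc_subset_Icc hs ht).trans <|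
      hK.intermediate_value ha hb hf.continuous.continuousOn) Subset.rfl
  calc ENNReal.ofReal (t - s) = μH[1] (Ioo s t) := by rw [hausdorffMeasure_real, Real.volume_Ioo]
    _ ≤ μH[1] (f '' (K ∩ f ⁻¹' Ioo s t)) := measure_mono hsub
    _ ≤ μH[1] (K ∩ f ⁻¹' Ioo s t) := by
      simpa using hf.hausdorffMeasure_image_le zero_le_one (K ∩ f ⁻¹' Ioo s t)

theorem ediam_le_hausdorffMeasure_of_isPreconnected (hK : IsPreconnected K) :
    ediam K ≤ μH[1] K := by
  refine ediam_le_iff.2 fun b hb a ha => ?_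
  have h := ofReal_sub_le_hausdorffMeasure_inter_preimage_Ioo hK (LipschitzWith.dist_left a) ha hb
    (dist_self a).le le_rfl
  rw [sub_zero, ← edist_dist] at h
  exact h.trans (measure_mono inter_subset_left)

end Preconnected

/-- A weighting `y` of the subsets of `ι` (the *cuts*) that is supported on nonempty subsets
avoiding the root `r` and packs into the metric of the points `x i`: the cuts separating two of the
points have total weight at most their distance. -/
structure IsCutPacking {ι X : Type*} [Fintype ι] [DecidableEq ι] [PseudoMetricSpace X]
    (x : ι → X) (r : ι) (y : Finset ι → ℝ) : Prop where
  nonneg : ∀ S, 0 ≤ y S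
  root : ∀ S, r ∈ S → y S = 0
  empty : y ∅ = 0
  sum_separating_le : ∀ i j, ∑ S with ¬(i ∈ S ↔ j ∈ S), y S ≤ dist (x i) (x j)

namespace IsCutPacking

section Moats

variable {ι X : Type*} [Fintype ι] [DecidableEq ι]

/-- The radius around the point `i` at which the moat of the cut `S ∋ i` starts: the total weight of
the cuts nested strictly between `{i}` and `S`, `{i}` included. -/
def innerRadius (y : Finset ι → ℝ) (S : Finset ι) (i : ι) : ℝ :=
  ∑ T with i ∈ T ∧ T ⊂ S, y T

/-- The radius around the point `i` at which the moat of the cut `S ∋ i` ends. -/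
def outerRadius (y : Finset ι → ℝ) (S : Finset ι) (i : ι) : ℝ :=
  ∑ T with i ∈ T ∧ T ⊆ S, y T

/-- The moat of the cut `S`: the annular region of width `y S` around the points `x i`, `i ∈ S`,
which surrounds the moats of the cuts contained in `S`. -/
def moat [PseudoMetricSpace X] (x : ι → X) (y : Finset ι → ℝ) (S : Finset ι) : Set X :=
  {z | (∀ i ∈ S, innerRadius y S i < dist z (x i)) ∧ ∃ i ∈ S, dist z (x i) < outerRadius y S i}

theorem innerRadius_add (y : Finset ι → ℝ) {S : Finset ι} {i : ι} (hi : i ∈ S) :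
    innerRadius y S i + y S = outerRadius y S i := by
  have h : ({T | i ∈ T ∧ T ⊆ S} : Finset (Finset ι)) =
      insert S ({T | i ∈ T ∧ T ⊂ S} : Finset (Finset ι)) := by
    ext T
    simp only [Finset.mem_filter_univ, Finset.mem_insert, subset_iff_ssubset_or_eq]
    grind
  rw [innerRadius, outerRadius, h, Finset.sum_insert (by simp), add_comm]

variable [PseudoMetricSpace X] {x : ι → X} {r : ι} {y : Finset ι → ℝ} {S T : Finset ι}

theorem isOpen_moat (x : ι → X) (y : Finset ι → ℝ) (S : Finset ι) : IsOpen (moat x y S) := by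
  have heq : moat x y S = (⋂ i ∈ S, {z | innerRadius y S i < dist z (x i)}) ∩
      ⋃ i ∈ S, {z | dist z (x i) < outerRadius y S i} := by ext; simp [moat]
  rw [heq]
  refine .inter (isOpen_biInter_finset fun i _ => ?_) (isOpen_biUnion fun i _ => ?_)
  · exact isOpen_lt (by fun_prop) (by fun_prop)
  · exact isOpen_lt (by fun_prop) (by fun_prop)

theorem sum_le_sum_of_imp (h : IsCutPacking x r y) {p q : Finset ι → Prop} [DecidablePred p]
    [DecidablePred q] (hpq : ∀ U, p U → q U) : ∑ U with p U, y U ≤ ∑ U with q U, y U :=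
  Finset.sum_le_sum_of_subset_of_nonneg (Finset.monotone_filter_right _ fun U _ => hpq U)
    fun U _ _ => h.nonneg U

theorem outerRadius_le_innerRadius (h : IsCutPacking x r y) (hST : S ⊂ T) (i : ι) :
    outerRadius y S i ≤ innerRadius y T i :=
  h.sum_le_sum_of_imp fun _ hU => ⟨hU.1, hU.2.trans_ssubset hST⟩

theorem outerRadius_le_dist_root (h : IsCutPacking x r y) (hr : r ∉ S) (j : ι) :
    outerRadius y S j ≤ dist (x r) (x j) :=
  (h.sum_le_sum_of_imp (q := fun U => ¬(r ∈ U ↔ j ∈ U))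
    fun _ hU hiff => hr (hU.2 (hiff.2 hU.1))).trans (h.sum_separating_le r j)

theorem outerRadius_add_outerRadius_le_dist (h : IsCutPacking x r y) (hST : Disjoint S T) {i j : ι}
    (hi : i ∈ S) (hj : j ∈ T) : outerRadius y S i + outerRadius y T j ≤ dist (x i) (x j) := by
  have hdisj : Disjoint ({U | i ∈ U ∧ U ⊆ S} : Finset (Finset ι))
      ({U | j ∈ U ∧ U ⊆ T} : Finset (Finset ι)) :=
    Finset.disjoint_filter.2 fun U _ hU hU' => Finset.disjoint_left.1 hST hi (hU'.2 hU.1)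
  rw [outerRadius, outerRadius, ← Finset.sum_union hdisj, ← Finset.filter_or]
  refine (h.sum_le_sum_of_imp fun U hU hiff => ?_).trans (h.sum_separating_le i j)
  rcases hU with hU | hU
  · exact Finset.disjoint_left.1 hST (hU.2 (hiff.1 hU.1)) hj
  · exact Finset.disjoint_left.1 hST hi (hU.2 (hiff.2 hU.1))

theorem disjoint_moat_of_ssubset (h : IsCutPacking x r y) (hST : S ⊂ T) :
    Disjoint (moat x y S) (moat x y T) := by
  rw [Set.disjoint_left]
  rintro z ⟨-, i, hi, hz⟩ ⟨hz', -⟩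
  exact (hz.trans_le (h.outerRadius_le_innerRadius hST i)).not_gt (hz' i (hST.subset hi))

theorem disjoint_moat_of_disjoint (h : IsCutPacking x r y) (hST : Disjoint S T) :
    Disjoint (moat x y S) (moat x y T) := by
  rw [Set.disjoint_left]
  rintro z ⟨-, i, hi, hzi⟩ ⟨-, j, hj, hzj⟩
  linarith [h.outerRadius_add_outerRadius_le_dist hST hi hj, dist_triangle_left (x i) (x j) z]

end Moats

section Laminar

variable {ι X : Type*} [Fintype ι] [DecidableEq ι] [MetricSpace X] [MeasurableSpace X]
  [BorelSpace X] {x : ι → X} {r : ι} {y : Finset ι → ℝ} {K : Set X}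

theorem ofReal_le_hausdorffMeasure_moat (h : IsCutPacking x r y) (hK : IsPreconnected K)
    (hx : ∀ i, x i ∈ K) (S : Finset ι) : ENNReal.ofReal (y S) ≤ μH[1] (K ∩ moat x y S) := by
  rcases S.eq_empty_or_nonempty with rfl | hS
  · simp [h.empty]
  by_cases hr : r ∈ S
  · simp [h.root S hr]
  let f : X → ℝ := fun z => S.inf' hS fun i => dist z (x i) - innerRadius y S i
  have hf : LipschitzWith 1 f := by
    refine LipschitzWith.of_le_add fun a b => ?_
    obtain ⟨i, hi, hb⟩ := S.exists_mem_eq_inf' hS fun i => dist b (x i) - innerRadius y S i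
    calc f a ≤ dist a (x i) - innerRadius y S i := Finset.inf'_le _ hi
      _ ≤ dist b (x i) - innerRadius y S i + dist a b := by linarith [dist_triangle a b (x i)]
      _ = f b + dist a b := by rw [← hb]
  have hsub : f ⁻¹' Ioo 0 (y S) ⊆ moat x y S := by
    rintro z ⟨hz, hz'⟩
    refine ⟨fun i hi => sub_pos.1 ((Finset.lt_inf'_iff hS).1 hz i hi), ?_⟩
    obtain ⟨i, hi, hlt⟩ := (Finset.inf'_lt_iff hS).1 hz'
    exact ⟨i, hi, innerRadius_add y hi ▸ sub_lt_iff_lt_add'.1 hlt⟩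
  obtain ⟨i, hi⟩ := hS
  have hfi : f (x i) ≤ 0 := (Finset.inf'_le _ hi).trans <| by
    rw [dist_self, zero_sub, neg_nonpos]
    exact Finset.sum_nonneg fun T _ => h.nonneg T
  have hfr : y S ≤ f (x r) := Finset.le_inf' _ _ fun j hj => by
    rw [le_sub_iff_add_le', innerRadius_add y hj]
    exact h.outerRadius_le_dist_root hr j
  calc ENNReal.ofReal (y S) ≤ μH[1] (K ∩ f ⁻¹' Ioo 0 (y S)) := by
        simpa using ofReal_sub_le_hausdorffMeasure_inter_preimage_Ioo hK hf (hx i) (hx r) hfi hfr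
    _ ≤ μH[1] (K ∩ moat x y S) := measure_mono (inter_subset_inter_right K hsub)

theorem ofReal_sum_le_hausdorffMeasure_of_laminar (h : IsCutPacking x r y) (hK : IsPreconnected K)
    (hx : ∀ i, x i ∈ K) (hlam : ∀ S T, y S ≠ 0 → y T ≠ 0 → S ⊆ T ∨ T ⊆ S ∨ Disjoint S T) :
    ENNReal.ofReal (∑ S, y S) ≤ μH[1] K := by
  have hdisj : Set.PairwiseDisjoint (({S | y S ≠ 0} : Finset (Finset ι)) : Set (Finset ι))
      (moat x y) := by
    intro S hS T hT hST
    rcases hlam S T (by simpa using hS) (by simpa using hT) with hsub | hsub | hdisj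
    · exact h.disjoint_moat_of_ssubset (hsub.ssubset_of_ne hST)
    · exact (h.disjoint_moat_of_ssubset (hsub.ssubset_of_ne hST.symm)).symm
    · exact h.disjoint_moat_of_disjoint hdisj
  have hmeas (S : Finset ι) : MeasurableSet (moat x y S) := (isOpen_moat x y S).measurableSet
  calc ENNReal.ofReal (∑ S, y S) = ∑ S with y S ≠ 0, ENNReal.ofReal (y S) := by
        rw [← Finset.sum_filter_ne_zero, ENNReal.ofReal_sum_of_nonneg fun S _ => h.nonneg S]
    _ ≤ ∑ S with y S ≠ 0, (μH[1]).restrict K (moat x y S) :=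
        Finset.sum_le_sum fun S _ => by
          rw [Measure.restrict_apply (hmeas S), inter_comm]
          exact h.ofReal_le_hausdorffMeasure_moat hK hx S
    _ = (μH[1]).restrict K (⋃ S ∈ ({S | y S ≠ 0} : Finset (Finset ι)), moat x y S) :=
        (measure_biUnion_finset hdisj fun S _ => hmeas S).symm
    _ ≤ (μH[1]).restrict K univ := measure_mono (subset_univ _)
    _ = μH[1] K := Measure.restrict_apply_univ K

end Laminar

section Uncross

variable {ι : Type*} [DecidableEq ι]

/-- The weighting obtained from `y` by moving the weight `ε` from the cuts `S` and `T` to the cuts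
`S ∩ T` and `S ∪ T`. -/
def uncross (y : Finset ι → ℝ) (S T : Finset ι) (ε : ℝ) : Finset ι → ℝ :=
  y + ε • (Pi.single (S ∩ T) 1 + Pi.single (S ∪ T) 1 - Pi.single S 1 - Pi.single T 1)

theorem dotProduct_uncross [Fintype ι] (g y : Finset ι → ℝ) (S T : Finset ι) (ε : ℝ) :
    g ⬝ᵥ uncross y S T ε = g ⬝ᵥ y + ε * (g (S ∩ T) + g (S ∪ T) - g S - g T) := by
  simp only [uncross, dotProduct_add, dotProduct_smul, dotProduct_sub, dotProduct_single, mul_one,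
    smul_eq_mul]

theorem uncross_nonneg {y : Finset ι → ℝ} (hy : ∀ U, 0 ≤ y U) {S T : Finset ι} (hST : S ≠ T)
    {ε : ℝ} (hε : 0 ≤ ε) (hS : ε ≤ y S) (hT : ε ≤ y T) (U : Finset ι) :
    0 ≤ uncross y S T ε U := by
  have hsingle (V : Finset ι) : 0 ≤ (Pi.single V ε : Finset ι → ℝ) U :=
    (Pi.single_nonneg (α := fun _ : Finset ι => ℝ)).2 hε U
  have hsub : (Pi.single S ε + Pi.single T ε : Finset ι → ℝ) U ≤ y U := by
    rcases eq_or_ne U S with rfl | hUS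
    · simpa [Pi.single_eq_of_ne hST] using hS
    rcases eq_or_ne U T with rfl | hUT
    · simpa [Pi.single_eq_of_ne hUS] using hT
    · simpa [Pi.single_eq_of_ne hUS, Pi.single_eq_of_ne hUT] using hy U
  have hadd := add_nonneg (hsingle (S ∩ T)) (hsingle (S ∪ T))
  simp only [uncross, smul_add, smul_sub, ← Pi.single_smul, smul_eq_mul, mul_one, Pi.add_apply,
    Pi.sub_apply] at hsub hadd ⊢
  linarith

theorem card_sq_add_card_sq_lt {S T : Finset ι} (hST : ¬S ⊆ T) (hTS : ¬T ⊆ S) :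
    (S.card ^ 2 + T.card ^ 2 : ℝ) < (S ∩ T).card ^ 2 + (S ∪ T).card ^ 2 := by
  have hunion : ((S ∪ T).card : ℝ) = S.card + T.card - (S ∩ T).card := by
    rw [eq_sub_iff_add_eq]
    exact_mod_cast Finset.card_union_add_card_inter S T
  have hS : ((S ∩ T).card : ℝ) < S.card := by
    exact_mod_cast Finset.card_lt_card (Finset.inter_subset_left.ssubset_of_ne
      (hST ∘ Finset.inter_eq_left.1))
  have hT : ((S ∩ T).card : ℝ) < T.card := by
    exact_mod_cast Finset.card_lt_card (Finset.inter_subset_right.ssubset_of_ne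
      (hTS ∘ Finset.inter_eq_right.1))
  rw [hunion]
  nlinarith [mul_pos (sub_pos.2 hS) (sub_pos.2 hT)]

variable [Fintype ι]

theorem sum_separating_eq_dotProduct (y : Finset ι → ℝ) (i j : ι) :
    ∑ S with ¬(i ∈ S ↔ j ∈ S), y S = (fun S => if i ∈ S ↔ j ∈ S then 0 else 1) ⬝ᵥ y := by
  simp [dotProduct, Finset.sum_filter, ite_not]

theorem sum_separating_uncross_le (y : Finset ι → ℝ) (S T : Finset ι) {ε : ℝ} (hε : 0 ≤ ε)
    (i j : ι) : ∑ U with ¬(i ∈ U ↔ j ∈ U), uncross y S T ε U ≤ ∑ U with ¬(i ∈ U ↔ j ∈ U), y U := by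
  rw [sum_separating_eq_dotProduct, sum_separating_eq_dotProduct, dotProduct_uncross]
  refine add_le_of_nonpos_right (mul_nonpos_of_nonneg_of_nonpos hε ?_)
  by_cases iS : i ∈ S <;> by_cases iT : i ∈ T <;> by_cases jS : j ∈ S <;> by_cases jT : j ∈ T <;>
    simp [iS, iT, jS, jT]

variable {X : Type*} [PseudoMetricSpace X] {x : ι → X} {r : ι} {y : Finset ι → ℝ}

theorem isCutPacking_uncross (h : IsCutPacking x r y) {S T : Finset ι} (hST : ¬S ⊆ T)
    (hTS : ¬T ⊆ S) (hd : ¬Disjoint S T) (hrS : r ∉ S) (hrT : r ∉ T) {ε : ℝ} (hε : 0 ≤ ε)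
    (hS : ε ≤ y S) (hT : ε ≤ y T) : IsCutPacking x r (uncross y S T ε) where
  nonneg := uncross_nonneg h.nonneg (fun heq => hST heq.subset) hε hS hT
  root U hU := by
    have : U ≠ S := by grind
    have : U ≠ T := by grind
    have : U ≠ S ∩ T := by grind
    have : U ≠ S ∪ T := by grind
    simp [uncross, h.root U hU, *]
  empty := by
    have : ∅ ≠ S := by grind
    have : ∅ ≠ T := by grind
    have : ∅ ≠ S ∩ T := fun heq => hd (Finset.disjoint_iff_inter_eq_empty.2 heq.symm)
    have : ∅ ≠ S ∪ T := by grind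
    simp [uncross, h.empty, *]
  sum_separating_le i j := (sum_separating_uncross_le y S T hε i j).trans (h.sum_separating_le i j)

theorem apply_le_sum_dist (h : IsCutPacking x r y) (S : Finset ι) :
    y S ≤ ∑ i, dist (x r) (x i) := by
  by_cases hr : r ∈ S
  · exact (h.root S hr).trans_le (Finset.sum_nonneg fun _ _ => dist_nonneg)
  rcases S.eq_empty_or_nonempty with rfl | ⟨i, hi⟩
  · exact h.empty.trans_le (Finset.sum_nonneg fun _ _ => dist_nonneg)
  calc y S ≤ ∑ U with ¬(r ∈ U ↔ i ∈ U), y U :=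
        Finset.single_le_sum (fun U _ => h.nonneg U) (by simp [hr, hi])
    _ ≤ dist (x r) (x i) := h.sum_separating_le r i
    _ ≤ ∑ i, dist (x r) (x i) :=
        Finset.single_le_sum (f := fun i => dist (x r) (x i)) (fun _ _ => dist_nonneg)
          (Finset.mem_univ i)

theorem isCompact_setOf (x : ι → X) (r : ι) : IsCompact {y | IsCutPacking x r y} := by
  have hclosed : IsClosed {y | IsCutPacking x r y} := by
    have heq : {y | IsCutPacking x r y} = {y | (∀ S, 0 ≤ y S) ∧ (∀ S, r ∈ S → y S = 0) ∧ y ∅ = 0 ∧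
        ∀ i j, ∑ S with ¬(i ∈ S ↔ j ∈ S), y S ≤ dist (x i) (x j)} :=
      Set.ext fun y => ⟨fun h => ⟨h.1, h.2, h.3, h.4⟩, fun h => ⟨h.1, h.2.1, h.2.2.1, h.2.2.2⟩⟩
    simp only [heq, ofPred_and, ofPred_forall]
    refine .inter (isClosed_iInter fun S => ?_) <| .inter
      (isClosed_iInter fun S => isClosed_iInter fun _ => ?_) <| .inter ?_
      (isClosed_iInter fun i => isClosed_iInter fun j => ?_)
    · exact isClosed_le (by fun_prop) (by fun_prop)
    · exact isClosed_eq (by fun_prop) (by fun_prop)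
    · exact isClosed_eq (by fun_prop) (by fun_prop)
    · exact isClosed_le (by fun_prop) (by fun_prop)
  exact (isCompact_univ_pi fun _ => isCompact_Icc).of_isClosed_subset hclosed
    fun y h S _ => ⟨h.nonneg S, h.apply_le_sum_dist S⟩

-- Uncrossing preserves the total weight and increases `∑ S, |S|² y S`, so a maximiser is laminar.
theorem exists_laminar (h : IsCutPacking x r y) :
    ∃ y', IsCutPacking x r y' ∧ ∑ S, y' S = ∑ S, y S ∧
      ∀ S T, y' S ≠ 0 → y' T ≠ 0 → S ⊆ T ∨ T ⊆ S ∨ Disjoint S T := by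
  let cardSq : Finset ι → ℝ := fun S => S.card ^ 2
  have hcompact : IsCompact {y' | IsCutPacking x r y' ∧ ∑ S, y' S = ∑ S, y S} :=
    (isCompact_setOf x r).inter_right (isClosed_eq (by fun_prop) (by fun_prop))
  obtain ⟨y', ⟨hy', hsum⟩, hmax⟩ := hcompact.exists_isMaxOn ⟨y, h, rfl⟩
    (f := fun y' => cardSq ⬝ᵥ y') (by fun_prop)
  refine ⟨y', hy', hsum, fun S T hS hT => ?_⟩
  by_contra! hcross
  obtain ⟨hST, hTS, hd⟩ := hcross
  let ε := min (y' S) (y' T)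
  have hε : 0 < ε := lt_min ((hy'.nonneg S).lt_of_ne' hS) ((hy'.nonneg T).lt_of_ne' hT)
  have hpack : IsCutPacking x r (uncross y' S T ε) :=
    hy'.isCutPacking_uncross hST hTS hd (mt (hy'.root S) hS) (mt (hy'.root T) hT) hε.le
      (min_le_left _ _) (min_le_right _ _)
  have htotal : ∑ U, uncross y' S T ε U = ∑ U, y U := by
    simpa [hsum, one_dotProduct] using dotProduct_uncross 1 y' S T ε
  have hle : cardSq ⬝ᵥ uncross y' S T ε ≤ cardSq ⬝ᵥ y' := hmax ⟨hpack, htotal⟩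
  rw [dotProduct_uncross, add_le_iff_nonpos_right] at hle
  have hlt := card_sq_add_card_sq_lt hST hTS
  exact hle.not_gt (mul_pos hε (by simp only [cardSq]; linarith))

end Uncross

theorem ofReal_sum_le_hausdorffMeasure {ι X : Type*} [Fintype ι] [DecidableEq ι] [MetricSpace X]
    [MeasurableSpace X] [BorelSpace X] {x : ι → X} {r : ι} {y : Finset ι → ℝ} {K : Set X}
    (h : IsCutPacking x r y) (hK : IsPreconnected K) (hx : ∀ i, x i ∈ K) :
    ENNReal.ofReal (∑ S, y S) ≤ μH[1] K := by
  obtain ⟨y', hy', hsum, hlam⟩ := h.exists_laminar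
  exact hsum ▸ hy'.ofReal_sum_le_hausdorffMeasure_of_laminar hK hx hlam

end IsCutPacking

section Signature

variable {ι Ω : Type*} [Fintype ι] {B : ι → Set Ω}

/-- The set of indices of the members of the family `B` which contain the point `ω`. The fibres of
`signature B` are the atoms of the finite set algebra generated by `B`. -/
noncomputable def signature (B : ι → Set Ω) (ω : Ω) : Finset ι := by
  classical exact {i | ω ∈ B i}

theorem mem_signature {ω : Ω} {i : ι} : i ∈ signature B ω ↔ ω ∈ B i := by
  simp [signature]

theorem preimage_signature_singleton (S : Finset ι) :
    signature B ⁻¹' {S} = ⋂ i, {ω | ω ∈ B i ↔ i ∈ S} := by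
  ext ω
  simp [Finset.ext_iff, mem_signature]

variable [MeasurableSpace Ω]

theorem measurableSet_preimage_signature_singleton (hB : ∀ i, MeasurableSet (B i)) (S : Finset ι) :
    MeasurableSet (signature B ⁻¹' {S}) := by
  rw [preimage_signature_singleton]
  exact .iInter fun i => (hB i).iff (.const _)

theorem isCutPacking_signature [DecidableEq ι] {X : Type*} [PseudoMetricSpace X] {x : ι → X} {r : ι}
    {ν : Measure Ω} [IsFiniteMeasure ν] (hB : ∀ i, MeasurableSet (B i)) (hr : B r = ∅)
    (hν : ν (⋃ i, B i)ᶜ = 0) (hle : ∀ i j, ν (B i ∆ B j) ≤ edist (x i) (x j)) :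
    IsCutPacking x r fun S => ν.real (signature B ⁻¹' {S}) where
  nonneg _ := measureReal_nonneg
  root S hS := by
    have hempty : signature B ⁻¹' {S} = ∅ := by
      rw [preimage_signature_singleton, eq_empty_iff_forall_notMem]
      intro ω hω
      simpa [hr, hS] using mem_iInter.1 hω r
    rw [hempty, measureReal_empty]
  empty := by
    have hcompl : signature B ⁻¹' {∅} = (⋃ i, B i)ᶜ := by
      simp [preimage_signature_singleton, compl_def, ofPred_forall]
    rw [hcompl, measureReal_def, hν, ENNReal.toReal_zero]
  sum_separating_le i j := by
    have hpre : signature B ⁻¹' ({S | ¬(i ∈ S ↔ j ∈ S)} : Finset (Finset ι)) = B i ∆ B j := by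
      ext ω
      simp only [Finset.coe_filter_univ, mem_preimage, mem_ofPred_eq, mem_signature, mem_symmDiff]
      tauto
    rw [sum_measureReal_preimage_singleton _ fun S _ =>
      measurableSet_preimage_signature_singleton hB S, hpre, dist_edist]
    exact ENNReal.toReal_mono (edist_ne_top _ _) (hle i j)

end Signature

theorem measure_iUnion_symmDiff_le_hausdorffMeasure {ι X Ω : Type*} [Finite ι] [MetricSpace X]
    [MeasurableSpace X] [BorelSpace X] [MeasurableSpace Ω] {μ : Measure Ω} {A : ι → Set Ω}
    {x : ι → X} {K : Set X} (hK : IsPreconnected K) (hx : ∀ i, x i ∈ K)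
    (hA : ∀ i, MeasurableSet (A i)) (hle : ∀ i j, μ (A i ∆ A j) ≤ edist (x i) (x j)) (r : ι) :
    μ (⋃ i, A i ∆ A r) ≤ μH[1] K := by
  classical
  have := Fintype.ofFinite ι
  let B (i : ι) : Set Ω := A i ∆ A r
  let ν := μ.restrict (⋃ i, B i)
  have hB (i : ι) : MeasurableSet (B i) := (hA i).symmDiff (hA r)
  have hunion : MeasurableSet (⋃ i, B i) := .iUnion hB
  have hBB (i j : ι) : B i ∆ B j = A i ∆ A j := by
    rw [symmDiff_symmDiff_symmDiff_comm, symmDiff_self, symmDiff_bot]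
  have hfinite : μ (⋃ i, B i) ≠ ⊤ := by
    refine (measure_iUnion_fintype_le μ B).trans_lt ?_ |>.ne
    exact ENNReal.sum_lt_top.2 fun i _ => (hle i r).trans_lt (edist_lt_top _ _)
  have : IsFiniteMeasure ν := isFiniteMeasure_restrict.2 hfinite
  have hν : ν (⋃ i, B i)ᶜ = 0 := by
    rw [Measure.restrict_apply hunion.compl, compl_inter_self, measure_empty]
  have hpack : IsCutPacking x r fun S => ν.real (signature B ⁻¹' {S}) :=
    isCutPacking_signature hB (symmDiff_self _) hν
      fun i j => (Measure.restrict_apply_le _ _).trans ((hBB i j).symm ▸ hle i j)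
  have htotal : ENNReal.ofReal (∑ S, ν.real (signature B ⁻¹' {S})) = μ (⋃ i, B i) := by
    rw [sum_measureReal_preimage_singleton _ fun S _ =>
      measurableSet_preimage_signature_singleton hB S]
    simp [ν, ofReal_measureReal hfinite]
  exact htotal.symm.trans_le (hpack.ofReal_sum_le_hausdorffMeasure hK hx)

section Crofton

theorem integral_max_cos_sub_zero (φ : ℝ) :
    ∫ θ in 0..2 * Real.pi, max (Real.cos (θ - φ)) 0 = 2 := by
  have hperiodic : Function.Periodic (fun θ => max (Real.cos θ) 0) (2 * Real.pi) := fun θ => by simp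
  have hpos : ∫ θ in -(Real.pi / 2)..Real.pi / 2, max (Real.cos θ) 0 =
      ∫ θ in -(Real.pi / 2)..Real.pi / 2, Real.cos θ := by
    refine intervalIntegral.integral_congr fun θ hθ => max_eq_left ?_
    rw [uIcc_of_le (by linarith [Real.pi_pos])] at hθ
    exact Real.cos_nonneg_of_mem_Icc hθ
  have hneg : ∫ θ in Real.pi / 2..-(Real.pi / 2) + 2 * Real.pi, max (Real.cos θ) 0 =
      ∫ θ in Real.pi / 2..-(Real.pi / 2) + 2 * Real.pi, 0 := by
    refine intervalIntegral.integral_congr fun θ hθ => max_eq_right ?_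
    rw [uIcc_of_le (by linarith [Real.pi_pos])] at hθ
    exact Real.cos_nonpos_of_pi_div_two_le_of_le hθ.1 (by linarith [hθ.2])
  have hint (s t : ℝ) : IntervalIntegrable (fun θ => max (Real.cos θ) 0) volume s t :=
    (by fun_prop : Continuous fun θ => max (Real.cos θ) 0).intervalIntegrable s t
  calc ∫ θ in 0..2 * Real.pi, max (Real.cos (θ - φ)) 0
      = ∫ θ in -φ..-φ + 2 * Real.pi, max (Real.cos θ) 0 := by
        rw [intervalIntegral.integral_comp_sub_right fun θ => max (Real.cos θ) 0]; ring_nf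
    _ = ∫ θ in -(Real.pi / 2)..-(Real.pi / 2) + 2 * Real.pi, max (Real.cos θ) 0 :=
        hperiodic.intervalIntegral_add_eq _ _
    _ = 2 := by
        rw [← intervalIntegral.integral_add_adjacent_intervals (hint _ _) (hint _ _), hpos, hneg]
        norm_num [integral_cos]

/-- The kinematic measure on the oriented lines of the plane, a line being given by the angle of its
unit normal and its signed distance from the origin. It is normalised so that the lines separating
two points have measure equal to the distance of the points. -/
noncomputable def lineMeasure : Measure (ℝ × ℝ) :=
  (4⁻¹ : ℝ≥0∞) • (volume.restrict (Ioc 0 (2 * Real.pi))).prod volume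

variable {V : Type*} [NormedAddCommGroup V] [InnerProductSpace ℝ V]
  (b : OrthonormalBasis (Fin 2) ℝ V)

/-- The unit vector at angle `θ` from the first vector of the orthonormal basis `b`. -/
noncomputable def direction (θ : ℝ) : V :=
  Real.cos θ • b 0 + Real.sin θ • b 1

/-- The lines `(θ, t)` having the point `a` strictly below them, with respect to the height
function `⟪direction b θ, ·⟫`. -/
def linesAbove (a : V) : Set (ℝ × ℝ) :=
  {p | ⟪direction b p.1, a⟫ < p.2}

/-- The lines crossed upwards on the way from `a` to `c`. -/
def upCrossing (a c : V) : Set (ℝ × ℝ) :=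
  linesAbove b a \ linesAbove b c

theorem inner_direction (θ : ℝ) (v : V) :
    ⟪direction b θ, v⟫ = Real.cos θ * ⟪b 0, v⟫ + Real.sin θ * ⟪b 1, v⟫ := by
  simp only [direction, inner_add_left, real_inner_smul_left]

theorem exists_inner_direction_eq (v : V) :
    ∃ φ, ∀ θ, ⟪direction b θ, v⟫ = ‖v‖ * Real.cos (θ - φ) := by
  let z : ℂ := ⟨⟪b 0, v⟫, ⟪b 1, v⟫⟩
  have hz : ‖z‖ = ‖v‖ := by
    rw [← sq_eq_sq₀ (norm_nonneg _) (norm_nonneg _), Complex.sq_norm, Complex.normSq_apply,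
      ← b.sum_sq_inner_right, Fin.sum_univ_two, sq, sq]
  refine ⟨z.arg, fun θ => ?_⟩
  have hcos : ‖v‖ * Real.cos z.arg = ⟪b 0, v⟫ := hz ▸ Complex.norm_mul_cos_arg z
  have hsin : ‖v‖ * Real.sin z.arg = ⟪b 1, v⟫ := hz ▸ Complex.norm_mul_sin_arg z
  rw [inner_direction, Real.cos_sub]
  linear_combination -Real.cos θ * hcos - Real.sin θ * hsin

theorem measurableSet_linesAbove (a : V) : MeasurableSet (linesAbove b a) := by
  simp only [linesAbove, inner_direction]
  exact measurableSet_lt (by fun_prop) (by fun_prop)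

theorem measurableSet_upCrossing (a c : V) : MeasurableSet (upCrossing b a c) :=
  (measurableSet_linesAbove b a).diff (measurableSet_linesAbove b c)

theorem prodMk_preimage_upCrossing (a c : V) (θ : ℝ) :
    Prod.mk θ ⁻¹' upCrossing b a c = Ioc ⟪direction b θ, a⟫ ⟪direction b θ, c⟫ := by
  ext t
  simp [upCrossing, linesAbove]

theorem lineMeasure_upCrossing (a c : V) : lineMeasure (upCrossing b a c) = edist a c / 2 := by
  obtain ⟨φ, hφ⟩ := exists_inner_direction_eq b (c - a)
  have hslice (θ : ℝ) : volume (Prod.mk θ ⁻¹' upCrossing b a c) =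
      ENNReal.ofReal (dist a c * max (Real.cos (θ - φ)) 0) := by
    rw [prodMk_preimage_upCrossing, Real.volume_Ioc, ← inner_sub_right, hφ, ← dist_eq_norm',
      mul_max_of_nonneg _ _ dist_nonneg, mul_zero, ENNReal.ofReal_max, ENNReal.ofReal_zero,
      max_eq_left zero_le]
  have hlint : ∫⁻ θ in Ioc 0 (2 * Real.pi), ENNReal.ofReal (dist a c * max (Real.cos (θ - φ)) 0) =
      ENNReal.ofReal (dist a c * 2) := by
    rw [← ofReal_integral_eq_lintegral_ofReal (Continuous.integrableOn_Ioc (by fun_prop))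
      (.of_forall fun θ => mul_nonneg dist_nonneg (le_max_right _ _)),
      ← intervalIntegral.integral_of_le (by positivity), intervalIntegral.integral_const_mul,
      integral_max_cos_sub_zero]
  rw [lineMeasure, Measure.smul_apply, Measure.prod_apply (measurableSet_upCrossing b a c)]
  simp_rw [hslice]
  rw [hlint, ENNReal.ofReal_mul dist_nonneg, ← edist_dist, ENNReal.ofReal_ofNat,
    smul_eq_mul, mul_left_comm, div_eq_mul_inv]
  congr 1
  rw [show (4 : ℝ≥0∞) = 2 * 2 by norm_num, ENNReal.mul_inv (by simp) (by simp), mul_assoc,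
    ENNReal.inv_mul_cancel two_ne_zero ENNReal.ofNat_ne_top, mul_one]

theorem lineMeasure_symmDiff_linesAbove (a c : V) :
    lineMeasure (linesAbove b a ∆ linesAbove b c) = edist a c := by
  have hdisj : Disjoint (upCrossing b a c) (upCrossing b c a) := disjoint_sdiff_sdiff
  rw [symmDiff_def]
  change lineMeasure (upCrossing b a c ∪ upCrossing b c a) = edist a c
  rw [measure_union hdisj (measurableSet_upCrossing b c a),
    lineMeasure_upCrossing, lineMeasure_upCrossing, edist_comm c, ENNReal.add_halves]

theorem sum_edist_le_two_mul_hausdorffMeasure [MeasurableSpace V] [BorelSpace V] {K : Set V}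
    (hK : IsPreconnected K) {E : Finset (V × V)} (hE : ∀ e ∈ E, e.1 ∈ K ∧ e.2 ∈ K)
    (hdisj : (E : Set (V × V)).PairwiseDisjoint fun e => upCrossing b e.1 e.2) :
    ∑ e ∈ E, edist e.1 e.2 ≤ 2 * μH[1] K := by
  rcases E.eq_empty_or_nonempty with rfl | ⟨e₀, he₀⟩
  · simp
  let x : E ⊕ E → V := Sum.elim (fun e => e.1.1) fun e => e.1.2
  let r : E ⊕ E := .inl ⟨e₀, he₀⟩
  have hxK (i : E ⊕ E) : x i ∈ K := i.rec (fun e => (hE e e.2).1) fun e => (hE e e.2).2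
  have hsub : ⋃ e ∈ E, upCrossing b e.1 e.2 ⊆ ⋃ i, linesAbove b (x i) ∆ linesAbove b (x r) := by
    refine iUnion₂_subset fun e he => ?_
    calc upCrossing b e.1 e.2 ⊆ linesAbove b e.1 ∆ linesAbove b e.2 := subset_union_left
      _ ⊆ linesAbove b e.1 ∆ linesAbove b (x r) ∪ linesAbove b (x r) ∆ linesAbove b e.2 :=
          symmDiff_triangle _ _ _
      _ ⊆ ⋃ i, linesAbove b (x i) ∆ linesAbove b (x r) := by
          rw [symmDiff_comm _ (linesAbove b e.2)]
          exact union_subset (subset_iUnion_of_subset (.inl ⟨e, he⟩) Subset.rfl)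
            (subset_iUnion_of_subset (.inr ⟨e, he⟩) Subset.rfl)
  calc ∑ e ∈ E, edist e.1 e.2 = 2 * ∑ e ∈ E, lineMeasure (upCrossing b e.1 e.2) := by
        simp only [lineMeasure_upCrossing, Finset.mul_sum,
          ENNReal.mul_div_cancel two_ne_zero ENNReal.ofNat_ne_top]
    _ = 2 * lineMeasure (⋃ e ∈ E, upCrossing b e.1 e.2) := by
        rw [measure_biUnion_finset hdisj fun e _ => measurableSet_upCrossing b e.1 e.2]
    _ ≤ 2 * lineMeasure (⋃ i, linesAbove b (x i) ∆ linesAbove b (x r)) := by gcongr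
    _ ≤ 2 * μH[1] K := by
        gcongr
        exact measure_iUnion_symmDiff_le_hausdorffMeasure hK hxK
          (fun i => measurableSet_linesAbove b (x i))
          (fun i j => (lineMeasure_symmDiff_linesAbove b (x i) (x j)).le) r

end Crofton

section Support

variable {E : Type*} [NormedAddCommGroup E] [InnerProductSpace ℝ E]

theorem exists_add_smul_mem_frontier {Q : Set E} (hQ : Bornology.IsBounded Q) {c n : E}
    (hc : c ∈ closure Q) (hn : n ≠ 0) : ∃ t : ℝ, 0 ≤ t ∧ c + t • n ∈ frontier Q := by
  let ray : ℝ → E := fun t => c + t • n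
  have hray : Continuous ray := by fun_prop
  have hbdd : BddAbove (Ici 0 ∩ ray ⁻¹' closure Q) := by
    obtain ⟨R, hR⟩ := hQ.closure.subset_closedBall c
    refine ⟨R / ‖n‖, fun t ht => (le_div_iff₀ (norm_pos_iff.2 hn)).2 ?_⟩
    simpa [ray, norm_smul, abs_of_nonneg (mem_Ici.1 ht.1)] using hR ht.2
  -- The last point of the ray in `closure Q` cannot be interior.
  obtain ⟨t, ⟨ht0, htQ⟩, ht⟩ : ∃ t, IsGreatest (Ici 0 ∩ ray ⁻¹' closure Q) t :=
    ⟨_, (isClosed_Ici.inter (isClosed_closure.preimage hray)).isGreatest_csSup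
      ⟨0, by simpa [ray] using hc⟩ hbdd⟩
  refine ⟨t, ht0, htQ, fun hint => ?_⟩
  have hnear := (isOpen_interior.preimage hray).mem_nhds hint
  obtain ⟨s, hsQ, hs⟩ := (𝓝[>] t).nonempty_of_mem
    (inter_mem (mem_nhdsWithin_of_mem_nhds hnear) self_mem_nhdsWithin)
  exact (mem_Ioi.1 hs).not_ge
    (ht ⟨(mem_Ici.1 ht0).trans (mem_Ioi.1 hs).le, subset_closure (interior_subset hsQ)⟩)

theorem dist_le_dist_of_inner_sub_nonpos {c c' q q' : E} (h : ⟪q - c, c' - c⟫ ≤ 0)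
    (h' : ⟪q' - c', c - c'⟫ ≤ 0) : dist c c' ≤ dist q q' := by
  have hsq : dist c c' * dist c c' ≤ dist q q' * dist c c' := by
    calc dist c c' * dist c c' = ⟪c - c', c - c'⟫ := by
          rw [real_inner_self_eq_norm_mul_norm, dist_eq_norm]
      _ ≤ ⟪q - q', c - c'⟫ := by simp only [inner_sub_left, inner_sub_right] at h h' ⊢; linarith
      _ ≤ dist q q' * dist c c' := by
          simpa only [dist_eq_norm] using real_inner_le_norm (q - q') (c - c')
  rcases (dist_nonneg (x := c) (y := c')).eq_or_lt with h0 | h0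
  · exact h0 ▸ dist_nonneg
  · exact le_of_mul_le_mul_right hsq h0

variable [CompleteSpace E]

theorem exists_supporting_normal {C : Set E} (hC : Convex ℝ C) (hint : (interior C).Nonempty)
    {c : E} (hc : c ∈ frontier C) : ∃ n : E, n ≠ 0 ∧ ∀ x ∈ closure C, ⟪n, x⟫ ≤ ⟪n, c⟫ := by
  obtain ⟨f, hf0, hf⟩ := geometric_hahn_banach_of_nonempty_interior_point hC hc.2 hint
  refine ⟨(InnerProductSpace.toDual ℝ E).symm f, by simpa using hf0, ?_⟩
  simp only [InnerProductSpace.toDual_symm_apply]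
  exact closure_minimal hf (isClosed_le f.continuous continuous_const)

theorem exists_mem_frontier_inner_sub_nonpos {C Q : Set E} (hC : Convex ℝ C)
    (hint : (interior C).Nonempty) (hCQ : C ⊆ Q) (hQ : Bornology.IsBounded Q) {c : E}
    (hc : c ∈ frontier C) : ∃ q ∈ frontier Q, ∀ x ∈ closure C, ⟪q - c, x - c⟫ ≤ 0 := by
  obtain ⟨n, hn, hsup⟩ := exists_supporting_normal hC hint hc
  obtain ⟨t, ht, hq⟩ := exists_add_smul_mem_frontier hQ (closure_mono hCQ hc.1) hn
  refine ⟨_, hq, fun x hx => ?_⟩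
  rw [add_sub_cancel_left, real_inner_smul_left, inner_sub_right]
  exact mul_nonpos_of_nonneg_of_nonpos ht (sub_nonpos.2 (hsup x hx))

theorem hausdorffMeasure_frontier_mono_of_convex [MeasurableSpace E] [BorelSpace E] {C Q : Set E}
    (hC : Convex ℝ C) (hint : (interior C).Nonempty) (hCQ : C ⊆ Q) (hQ : Bornology.IsBounded Q)
    {d : ℝ} (hd : 0 ≤ d) : μH[d] (frontier C) ≤ μH[d] (frontier Q) := by
  choose q hqQ hq using fun c : frontier C =>
    exists_mem_frontier_inner_sub_nonpos hC hint hCQ hQ c.2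
  have hanti : AntilipschitzWith 1 q := AntilipschitzWith.of_le_mul_dist fun a b => by
    rw [NNReal.coe_one, one_mul]
    exact dist_le_dist_of_inner_sub_nonpos (hq a b b.2.1) (hq b a a.2.1)
  calc μH[d] (frontier C) = μH[d] (univ : Set (frontier C)) := by
        simpa using
          (isometry_subtype_coe (s := frontier C)).hausdorffMeasure_image (.inl hd) univ
    _ ≤ μH[d] (q '' univ) := by simpa using hanti.le_hausdorffMeasure_image hd univ
    _ ≤ μH[d] (frontier Q) := measure_mono (by rintro _ ⟨c, -, rfl⟩; exact hqQ c)

end Support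

section Segment

variable {E : Type*} [NormedAddCommGroup E] [InnerProductSpace ℝ E] {a b n z : E} {t : ℝ}

theorem exists_mem_segment_inner_eq (ht : t ∈ Icc ⟪n, a⟫ ⟪n, b⟫) :
    ∃ z ∈ segment ℝ a b, ⟪n, z⟫ = t :=
  (convex_segment a b).isPreconnected.intermediate_value (left_mem_segment ℝ a b)
    (right_mem_segment ℝ a b) (by fun_prop : ContinuousOn (fun z => ⟪n, z⟫) _) ht

theorem inner_le_of_mem_segment (hab : ⟪n, a⟫ ≤ ⟪n, b⟫) (hz : z ∈ segment ℝ a b) :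
    ⟪n, z⟫ ≤ ⟪n, b⟫ :=
  (convex_halfSpace_le (innerₛₗ ℝ n).isLinear ⟪n, b⟫).segment_subset hab (mem_ofPred.2 le_rfl) hz

end Segment

section Face

variable {E : Type*} [AddCommGroup E] [Module ℝ E]

theorem mem_convexHull_sep_eq_of_le {s : Set E} {z : E} (f : E →ₗ[ℝ] ℝ) (hz : z ∈ convexHull ℝ s)
    (hf : ∀ x ∈ s, f x ≤ f z) : z ∈ convexHull ℝ {x ∈ s | f x = f z} := by
  have hs : s = {x ∈ s | f x = f z} ∪ {x ∈ s | f x < f z} := by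
    ext x
    simpa [← and_or_left, ← le_iff_eq_or_lt] using hf x
  have hlt : convexHull ℝ {x ∈ s | f x < f z} ⊆ {x | f x < f z} :=
    convexHull_min (sep_subset_ofPred _ _) (convex_halfSpace_lt f.isLinear _)
  have heq : convexHull ℝ {x ∈ s | f x = f z} ⊆ {x | f x = f z} :=
    convexHull_min (sep_subset_ofPred _ _) (convex_hyperplane f.isLinear _)
  rcases {x ∈ s | f x = f z}.eq_empty_or_nonempty with hempty | hne
  · rw [hs, hempty, empty_union] at hz
    exact absurd (hlt hz) (lt_irrefl (f z))
  rcases {x ∈ s | f x < f z}.eq_empty_or_nonempty with hempty | hne'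
  · rwa [hs, hempty, union_empty] at hz
  rw [hs, convexHull_union hne hne', mem_convexJoin] at hz
  obtain ⟨p, hp, q, hq, hz⟩ := hz
  rw [segment_eq_image'] at hz
  obtain ⟨t, -, rfl⟩ := hz
  have hfp : f p = f (p + t • (q - p)) := heq hp
  have hfq : f q < f (p + t • (q - p)) := hlt hq
  have ht : t * (f q - f p) = 0 := by simpa using hfp
  rw [← hfp, ← sub_neg] at hfq
  simpa [(mul_eq_zero.1 ht).resolve_right hfq.ne] using hp

end Face

section Edge

variable {V : Type*} [NormedAddCommGroup V] [InnerProductSpace ℝ V] [Fact (finrank ℝ V = 2)]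
  (o : Orientation ℝ V (Fin 2)) {F : Set V} {a b a' b' n x y z z' : V}

theorem eq_of_inner_eq_of_areaForm_eq (hn : n ≠ 0) (hinner : ⟪n, x⟫ = ⟪n, y⟫)
    (harea : o.areaForm n x = o.areaForm n y) : x = y := by
  have h := o.inner_sq_add_areaForm_sq n (x - y)
  rw [inner_sub_right, hinner, map_sub, harea] at h
  simpa [hn, sub_eq_zero] using h.symm

theorem mem_segment_of_inner_eq_of_areaForm_mem_Icc (hn : n ≠ 0) (hx : ⟪n, x⟫ = ⟪n, z⟫)
    (hy : ⟪n, y⟫ = ⟪n, z⟫) (hz : o.areaForm n z ∈ Icc (o.areaForm n x) (o.areaForm n y)) :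
    z ∈ segment ℝ x y := by
  rw [← segment_eq_Icc (hz.1.trans hz.2)] at hz
  obtain ⟨s, t, hs, ht, hst, hz⟩ := hz
  refine ⟨s, t, hs, ht, hst, eq_of_inner_eq_of_areaForm_eq o hn ?_ (by simpa using hz)⟩
  rw [inner_add_right, real_inner_smul_right, real_inner_smul_right, hx, hy, ← add_mul, hst,
    one_mul]

theorem areaForm_sub_eq_zero_of_mem_segment (hz : z ∈ segment ℝ a b) :
    o.areaForm (b - a) (z - a) = 0 := by
  rw [segment_eq_image'] at hz
  obtain ⟨t, -, rfl⟩ := hz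
  rw [add_sub_cancel_left, map_smul, o.areaForm_apply_self, smul_zero]

theorem areaForm_nonneg_of_inner_pos (hx : 0 < ⟪n, x⟫) (hy : ⟪n, y⟫ = 0)
    (hxy : 0 ≤ o.areaForm x y) : 0 ≤ o.areaForm n y := by
  have h := o.inner_mul_areaForm_sub n x y
  rw [hy, mul_zero, sub_zero] at h
  exact nonneg_of_mul_nonneg_right (h ▸ by positivity) hx

/-- The ordered pair `(a, b)` of points of `F` spans an edge of the convex hull of `F`, which lies
to the left of it. Requiring the points of `F` on the line `ab` to lie between `a` and `b` makes
the edge maximal. -/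
structure IsEdge (F : Set V) (a b : V) : Prop where
  left_mem : a ∈ F
  right_mem : b ∈ F
  areaForm_nonneg : ∀ x ∈ F, 0 ≤ o.areaForm (b - a) (x - a)
  mem_segment : ∀ x ∈ F, o.areaForm (b - a) (x - a) = 0 → x ∈ segment ℝ a b

namespace IsEdge

variable {o}

theorem segment_subset (h : IsEdge o F a b) : segment ℝ a b ⊆ convexHull ℝ F :=
  segment_subset_convexHull h.left_mem h.right_mem

theorem areaForm_sub_nonneg (h : IsEdge o F a b) (hz : z ∈ segment ℝ a b)
    (hx : x ∈ convexHull ℝ F) : 0 ≤ o.areaForm (b - a) (x - z) := by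
  have hza := areaForm_sub_eq_zero_of_mem_segment o hz
  rw [(o.areaForm (b - a)).map_sub, sub_eq_zero] at hza
  rw [(o.areaForm (b - a)).map_sub, hza, sub_nonneg]
  refine convexHull_min (fun y hy => ?_) (convex_halfSpace_ge (o.areaForm (b - a)).isLinear _) hx
  simpa only [mem_ofPred_eq, (o.areaForm (b - a)).map_sub, sub_nonneg] using h.areaForm_nonneg y hy

theorem eq_of_inner_eq (h : IsEdge o F a b) (h' : IsEdge o F a' b') (hab : ⟪n, a⟫ < ⟪n, b⟫)
    (hab' : ⟪n, a'⟫ < ⟪n, b'⟫) (hz : z ∈ segment ℝ a b) (hz' : z' ∈ segment ℝ a' b')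
    (hzz' : ⟪n, z⟫ = ⟪n, z'⟫) : z = z' := by
  have hn : n ≠ 0 := by
    rintro rfl
    simp at hab
  have hle : 0 ≤ o.areaForm n (z' - z) :=
    areaForm_nonneg_of_inner_pos o (by simpa [inner_sub_right] using hab)
      (by simp [inner_sub_right, hzz']) (h.areaForm_sub_nonneg hz (h'.segment_subset hz'))
  have hge : 0 ≤ o.areaForm n (z - z') :=
    areaForm_nonneg_of_inner_pos o (by simpa [inner_sub_right] using hab')
      (by simp [inner_sub_right, hzz']) (h'.areaForm_sub_nonneg hz' (h.segment_subset hz))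
  rw [map_sub, sub_nonneg] at hle hge
  exact eq_of_inner_eq_of_areaForm_eq o hn hzz' (hle.antisymm hge)

theorem right_mem_segment_of_mem_segment (h : IsEdge o F a b) (h' : IsEdge o F a' b')
    (hz : z ∈ segment ℝ a b) (hz' : z ∈ segment ℝ a' b') (hne : z ≠ a') : b' ∈ segment ℝ a b := by
  refine h.mem_segment b' h'.right_mem (le_antisymm ?_ (h.areaForm_nonneg b' h'.right_mem))
  have hza := areaForm_sub_eq_zero_of_mem_segment o hz
  have ha' := h.areaForm_nonneg a' h'.left_mem
  rw [segment_eq_image'] at hz'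
  obtain ⟨t, ⟨ht0, ht1⟩, rfl⟩ := hz'
  have ht : 0 < t := ht0.lt_of_ne (by rintro rfl; simp at hne)
  simp only [map_sub, map_add, map_smul, smul_eq_mul] at hza ha' ⊢
  nlinarith [mul_nonneg (sub_nonneg.2 ht1) ha']

theorem left_unique (h : IsEdge o F a b) (h' : IsEdge o F a' b) : a = a' := by
  have hsum : o.areaForm (b - a) (a' - a) + o.areaForm (b - a') (a - a') = 0 := by
    simp only [map_sub, LinearMap.sub_apply, o.areaForm_apply_self, o.areaForm_swap a' a]
    ring
  have hnonneg := h.areaForm_nonneg a' h'.left_mem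
  have hnonneg' := h'.areaForm_nonneg a h.left_mem
  exact (wbtw_swap_left_iff ℝ b).1
    ⟨mem_segment_iff_wbtw.1 (h'.mem_segment a h.left_mem (by linarith)),
      mem_segment_iff_wbtw.1 (h.mem_segment a' h'.left_mem (by linarith))⟩ |>.symm

theorem eq_of_inner_lt_of_le (h : IsEdge o F a b) (h' : IsEdge o F a' b') {t : ℝ}
    (ha : ⟪n, a⟫ < t) (hb : t ≤ ⟪n, b⟫) (ha' : ⟪n, a'⟫ < t) (hb' : t ≤ ⟪n, b'⟫) :
    a = a' ∧ b = b' := by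
  have hab := ha.trans_le hb
  have hab' := ha'.trans_le hb'
  obtain ⟨z, hz, hzt⟩ := exists_mem_segment_inner_eq ⟨ha.le, hb⟩
  obtain ⟨z', hz', hzt'⟩ := exists_mem_segment_inner_eq ⟨ha'.le, hb'⟩
  obtain rfl : z = z' := h.eq_of_inner_eq h' hab hab' hz hz' (hzt.trans hzt'.symm)
  have hb'mem : b' ∈ segment ℝ a b :=
    h.right_mem_segment_of_mem_segment h' hz hz' (by rintro rfl; exact ha'.ne hzt)
  have hbmem : b ∈ segment ℝ a' b' :=
    h'.right_mem_segment_of_mem_segment h hz' hz (by rintro rfl; exact ha.ne hzt)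
  have hbb' : ⟪n, b⟫ = ⟪n, b'⟫ :=
    (inner_le_of_mem_segment hab'.le hbmem).antisymm (inner_le_of_mem_segment hab.le hb'mem)
  obtain rfl : b = b' :=
    h.eq_of_inner_eq h' hab hab' (right_mem_segment ℝ a b) (right_mem_segment ℝ a' b') hbb'
  exact ⟨h.left_unique h', rfl⟩

end IsEdge

theorem isEdge_of_areaForm_mem_Icc (hn : n ≠ 0) (hF : ∀ x ∈ F, ⟪n, x⟫ ≤ ⟪n, z⟫) (ha : a ∈ F)
    (hb : b ∈ F) (haz : ⟪n, a⟫ = ⟪n, z⟫) (hbz : ⟪n, b⟫ = ⟪n, z⟫)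
    (hab : o.areaForm n a < o.areaForm n b)
    (hmem : ∀ x ∈ F, ⟪n, x⟫ = ⟪n, z⟫ → o.areaForm n x ∈ Icc (o.areaForm n a) (o.areaForm n b)) :
    IsEdge o F a b := by
  have harea (x : V) : ‖n‖ ^ 2 * o.areaForm (b - a) (x - a) =
      (o.areaForm n b - o.areaForm n a) * (⟪n, z⟫ - ⟪n, x⟫) := by
    rw [← o.inner_mul_areaForm_sub, inner_sub_right, inner_sub_right, haz, hbz, map_sub, map_sub]
    ring
  have hnsq : 0 < ‖n‖ ^ 2 := by positivity
  refine ⟨ha, hb, fun x hx => ?_, fun x hx h0 => ?_⟩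
  · refine nonneg_of_mul_nonneg_right ?_ hnsq
    rw [harea]
    exact mul_nonneg (sub_nonneg.2 hab.le) (sub_nonneg.2 (hF x hx))
  · have hxz : ⟪n, x⟫ = ⟪n, z⟫ := by
      have h := harea x
      rw [h0, mul_zero, eq_comm, mul_eq_zero, or_iff_right (sub_pos.2 hab).ne', sub_eq_zero] at h
      exact h.symm
    exact mem_segment_of_inner_eq_of_areaForm_mem_Icc o hn (haz.trans hxz.symm)
      (hbz.trans hxz.symm) (hmem x hx hxz)

theorem mem_or_exists_isEdge_of_mem_frontier_convexHull (hF : F.Finite)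
    (hint : (interior (convexHull ℝ F)).Nonempty) (hz : z ∈ frontier (convexHull ℝ F)) :
    z ∈ F ∨ ∃ a b, IsEdge o F a b ∧ z ∈ segment ℝ a b := by
  have := FiniteDimensional.of_fact_finrank_eq_two (K := ℝ) (V := V)
  have := FiniteDimensional.complete ℝ V
  obtain ⟨n, hn, hsup⟩ := exists_supporting_normal (convex_convexHull ℝ F) hint hz
  have hF_le (x : V) (hx : x ∈ F) : ⟪n, x⟫ ≤ ⟪n, z⟫ :=
    hsup x (subset_closure (subset_convexHull ℝ F hx))
  let G : Set V := {x ∈ F | ⟪n, x⟫ = ⟪n, z⟫}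
  have hGfin : G.Finite := hF.subset (sep_subset _ _)
  have hzG : z ∈ convexHull ℝ G :=
    mem_convexHull_sep_eq_of_le (innerₛₗ ℝ n) ((hF.isClosed_convexHull ℝ).frontier_subset hz) hF_le
  have hGne : G.Nonempty := convexHull_nonempty_iff.1 ⟨z, hzG⟩
  obtain ⟨a, ⟨haF, haz⟩, hamin⟩ := G.exists_min_image (o.areaForm n) hGfin hGne
  obtain ⟨b, ⟨hbF, hbz⟩, hbmax⟩ := G.exists_max_image (o.areaForm n) hGfin hGne
  have hzab : z ∈ segment ℝ a b := by
    refine convexHull_min (fun x hx => ?_) (convex_segment a b) hzG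
    exact mem_segment_of_inner_eq_of_areaForm_mem_Icc o hn (haz.trans hx.2.symm)
      (hbz.trans hx.2.symm) ⟨hamin x hx, hbmax x hx⟩
  rcases (hamin b ⟨hbF, hbz⟩).eq_or_lt with hab | hab
  · obtain rfl := eq_of_inner_eq_of_areaForm_eq o hn (haz.trans hbz.symm) hab
    rw [segment_same, mem_singleton_iff] at hzab
    exact .inl (hzab ▸ haF)
  · exact .inr ⟨a, b, isEdge_of_areaForm_mem_Icc o hn hF_le haF hbF haz hbz hab
      fun x hx hxz => ⟨hamin x ⟨hx, hxz⟩, hbmax x ⟨hx, hxz⟩⟩, hzab⟩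

end Edge

section Polygon

variable {V : Type*} [NormedAddCommGroup V] [InnerProductSpace ℝ V] [Fact (finrank ℝ V = 2)]

theorem pairwiseDisjoint_upCrossing_isEdge (b : OrthonormalBasis (Fin 2) ℝ V)
    (o : Orientation ℝ V (Fin 2)) (F : Set V) :
    {e : V × V | IsEdge o F e.1 e.2}.PairwiseDisjoint fun e => upCrossing b e.1 e.2 := by
  intro e he e' he' hne
  refine disjoint_left.2 fun p hp hp' => hne ?_
  obtain ⟨h₁, h₂⟩ := he.eq_of_inner_lt_of_le he' hp.1 (not_lt.1 hp.2) hp'.1 (not_lt.1 hp'.2)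
  exact Prod.ext h₁ h₂

theorem hausdorffMeasure_frontier_convexHull_le_of_finite [MeasurableSpace V] [BorelSpace V]
    {F K : Set V} (hF : F.Finite) (hint : (interior (convexHull ℝ F)).Nonempty) (hFK : F ⊆ K)
    (hK : IsPreconnected K) : μH[1] (frontier (convexHull ℝ F)) ≤ 2 * μH[1] K := by
  have := FiniteDimensional.of_fact_finrank_eq_two (K := ℝ) (V := V)
  let b : OrthonormalBasis (Fin 2) ℝ V :=
    (stdOrthonormalBasis ℝ V).reindex (finCongr Fact.out)
  let o := b.toBasis.orientation
  have hE : {e : V × V | IsEdge o F e.1 e.2}.Finite :=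
    (hF.prod hF).subset fun e he => ⟨he.left_mem, he.right_mem⟩
  have hcover : frontier (convexHull ℝ F) ⊆ F ∪ ⋃ e ∈ hE.toFinset, segment ℝ e.1 e.2 := by
    intro z hz
    refine (mem_or_exists_isEdge_of_mem_frontier_convexHull o hF hint hz).imp_right ?_
    rintro ⟨a, c, hac, hz⟩
    exact mem_biUnion (x := (a, c)) (hE.mem_toFinset.2 hac) hz
  calc μH[1] (frontier (convexHull ℝ F))
      ≤ μH[1] (F ∪ ⋃ e ∈ hE.toFinset, segment ℝ e.1 e.2) := measure_mono hcover
    _ ≤ μH[1] F + μH[1] (⋃ e ∈ hE.toFinset, segment ℝ e.1 e.2) := measure_union_le _ _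
    _ ≤ 0 + ∑ e ∈ hE.toFinset, μH[1] (segment ℝ e.1 e.2) := by
        have := Measure.nullSingletonClass_hausdorff V one_pos
        gcongr
        · exact (hF.measure_zero _).le
        · exact measure_biUnion_finset_le _ _
    _ = ∑ e ∈ hE.toFinset, edist e.1 e.2 := by simp only [zero_add, hausdorffMeasure_segment]
    _ ≤ 2 * μH[1] K := by
        refine sum_edist_le_two_mul_hausdorffMeasure b hK (fun e he => ?_) ?_
        · have he := hE.mem_toFinset.1 he
          exact ⟨hFK he.left_mem, hFK he.right_mem⟩
        · simpa using pairwiseDisjoint_upCrossing_isEdge b o F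

end Polygon

section Approximation

variable {E : Type*} [NormedAddCommGroup E] [NormedSpace ℝ E]

theorem thickening_subset_homothety_image {C : Set E} (hC : Convex ℝ C) {z : E} {ρ η : ℝ}
    (hball : ball z ρ ⊆ C) (hη : 1 < η) :
    thickening ((η - 1) * ρ) C ⊆ AffineMap.homothety z η '' C := by
  intro x hx
  obtain ⟨c, hc, hxc⟩ := mem_thickening_iff.1 hx
  have hη' : 0 < η - 1 := sub_pos.2 hη
  have hη0 : η ≠ 0 := by positivity
  have hw : z + (η - 1)⁻¹ • (x - c) ∈ C := by
    refine hball ?_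
    rwa [mem_ball, dist_eq_norm, add_sub_cancel_left, norm_smul, norm_inv,
      Real.norm_of_nonneg hη'.le, inv_mul_lt_iff₀ hη', ← dist_eq_norm]
  refine ⟨η⁻¹ • c + (1 - η⁻¹) • (z + (η - 1)⁻¹ • (x - c)),
    hC hc hw (by positivity) (sub_nonneg.2 (inv_le_one_of_one_le₀ hη.le)) (by ring), ?_⟩
  rw [AffineMap.homothety_apply, vsub_eq_sub, vadd_eq_add]
  have := hη'.ne'
  match_scalars <;> field_simp <;> ring

theorem exists_finite_subset_homothety_image_convexHull [FiniteDimensional ℝ E] {K : Set E}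
    (hK : Bornology.IsBounded K) (hint : (interior (convexHull ℝ K)).Nonempty) {η : ℝ}
    (hη : 1 < η) :
    ∃ F ⊆ K, F.Finite ∧ (interior (convexHull ℝ F)).Nonempty ∧
      ∃ z, K ⊆ AffineMap.homothety z η '' convexHull ℝ F := by
  rw [interior_convexHull_nonempty_iff_affineSpan_eq_top] at hint
  obtain ⟨t, htK, hspan, hind⟩ := exists_affineIndependent ℝ E K
  obtain ⟨z, hz⟩ := interior_convexHull_nonempty_iff_affineSpan_eq_top.2 (hspan.trans hint)
  obtain ⟨ρ, hρ, hball⟩ := Metric.mem_nhds_iff.1 (mem_interior_iff_mem_nhds.1 hz)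
  obtain ⟨N, hNK, hNfin, hcover⟩ := finite_approx_of_totallyBounded
    (hK.isCompact_closure.totallyBounded.subset subset_closure) _ (mul_pos (sub_pos.2 hη) hρ)
  have ht : convexHull ℝ t ⊆ convexHull ℝ (t ∪ N) := convexHull_mono subset_union_left
  refine ⟨t ∪ N, union_subset htK hNK, (finite_set_of_fin_dim_affineIndependent ℝ hind).union hNfin,
    ⟨z, interior_mono ht hz⟩, z, ?_⟩
  calc K ⊆ ⋃ y ∈ N, ball y ((η - 1) * ρ) := hcover
    _ = thickening ((η - 1) * ρ) N := thickening_eq_biUnion_ball.symm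
    _ ⊆ thickening ((η - 1) * ρ) (convexHull ℝ (t ∪ N)) :=
        thickening_subset_of_subset _ (subset_union_right.trans (subset_convexHull ℝ _))
    _ ⊆ AffineMap.homothety z η '' convexHull ℝ (t ∪ N) :=
        thickening_subset_homothety_image (convex_convexHull ℝ _) (hball.trans ht) hη

theorem hausdorffMeasure_frontier_homothety_image [MeasurableSpace E] [BorelSpace E] {d : ℝ}
    (hd : 0 ≤ d) (z : E) {η : ℝ} (hη : η ≠ 0) (s : Set E) :
    μH[d] (frontier (AffineMap.homothety z η '' s)) = ‖η‖₊ ^ d • μH[d] (frontier s) := by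
  have hbij : Function.Bijective (AffineMap.homothety z η) :=
    (AffineEquiv.homothetyUnitsMulHom z (Units.mk0 η hη)).bijective
  rw [← (IsHomeomorph.mk (AffineMap.homothety_continuous z η)
    (AffineMap.homothety_isOpenMap z η hη) hbij).image_frontier,
    hausdorffMeasure_homothety_image hd z hη]

end Approximation

section Collinear

variable {E : Type*} [NormedAddCommGroup E] [NormedSpace ℝ E]

theorem hausdorffMeasure_one_le_ediam_of_collinear [MeasurableSpace E] [BorelSpace E] {s : Set E}
    (hs : Collinear ℝ s) : μH[1] s ≤ ediam s := by
  obtain ⟨p, v, hv⟩ := (collinear_iff_exists_forall_eq_smul_vadd s).1 hs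
  let line : ℝ → E := fun t => t • v + p
  have hedist (t u : ℝ) : edist (line t) (line u) = ‖v‖ₑ * edist t u := by
    rw [edist_add_right, edist_eq_enorm_sub, ← sub_smul, enorm_smul, mul_comm, edist_eq_enorm_sub]
  have himage : line '' (line ⁻¹' s) = s :=
    image_preimage_eq_of_subset fun x hx => (hv x hx).imp fun _ => Eq.symm
  have hlip : LipschitzWith ‖v‖₊ line := fun t u => (hedist t u).le
  calc μH[1] s = μH[1] (line '' (line ⁻¹' s)) := by rw [himage]
    _ ≤ ‖v‖ₑ * volume (line ⁻¹' s) := by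
        simpa [hausdorffMeasure_real] using! hlip.hausdorffMeasure_image_le zero_le_one (line ⁻¹' s)
    _ ≤ ‖v‖ₑ * ediam (line ⁻¹' s) := by gcongr; exact Real.volume_le_diam _
    _ = ediam (line '' (line ⁻¹' s)) := by
        simp only [ediam, iSup_image, hedist, ENNReal.mul_iSup]
    _ = ediam s := by rw [himage]

end Collinear

section Plane

theorem collinear_of_affineSpan_ne_top {k V P : Type*} [DivisionRing k] [AddCommGroup V]
    [Module k V] [AddTorsor V P] [Fact (finrank k V = 2)] {s : Set P} (hs : affineSpan k s ≠ ⊤) :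
    Collinear k s := by
  have := FiniteDimensional.of_fact_finrank_eq_two (K := k) (V := V)
  rcases s.eq_empty_or_nonempty with rfl | hne
  · exact collinear_empty k P
  rw [Ne, AffineSubspace.affineSpan_eq_top_iff_vectorSpan_eq_top_of_nonempty k V P hne] at hs
  have hlt : finrank k (vectorSpan k s) < 2 :=
    (Submodule.finrank_lt hs).trans_eq Fact.out
  exact collinear_iff_finrank_le_one.2 (Nat.lt_succ_iff.1 hlt)

variable {V : Type*} [NormedAddCommGroup V] [InnerProductSpace ℝ V] [Fact (finrank ℝ V = 2)]
  {K : Set V}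

theorem collinear_closure_convexHull_of_interior_eq_empty
    (hint : interior (convexHull ℝ K) = ∅) : Collinear ℝ (closure (convexHull ℝ K)) := by
  have := FiniteDimensional.of_fact_finrank_eq_two (K := ℝ) (V := V)
  rw [← not_nonempty_iff_eq_empty, interior_convexHull_nonempty_iff_affineSpan_eq_top] at hint
  have hsub : closure (convexHull ℝ K) ⊆ affineSpan ℝ K :=
    closure_minimal (convexHull_subset_affineSpan K) (affineSpan ℝ K).closed_of_finiteDimensional
  exact collinear_of_affineSpan_ne_top fun htop => hint (top_le_iff.1 (htop ▸ affineSpan_le.2 hsub))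

variable [MeasurableSpace V] [BorelSpace V]

theorem hausdorffMeasure_frontier_convexHull_le_of_interior_eq_empty (hK : IsPreconnected K)
    (hint : interior (convexHull ℝ K) = ∅) : μH[1] (frontier (convexHull ℝ K)) ≤ μH[1] K :=
  calc μH[1] (frontier (convexHull ℝ K))
      ≤ μH[1] (closure (convexHull ℝ K)) := measure_mono frontier_subset_closure
    _ ≤ ediam (closure (convexHull ℝ K)) :=
        hausdorffMeasure_one_le_ediam_of_collinear
          (collinear_closure_convexHull_of_interior_eq_empty hint)
    _ = ediam K := by rw [ediam_closure, convexHull_ediam]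
    _ ≤ μH[1] K := ediam_le_hausdorffMeasure_of_isPreconnected hK

theorem hausdorffMeasure_frontier_convexHull_le_ofReal_mul (hK : IsPreconnected K)
    (hbdd : Bornology.IsBounded K) (hint : (interior (convexHull ℝ K)).Nonempty) {η : ℝ}
    (hη : 1 < η) :
    μH[1] (frontier (convexHull ℝ K)) ≤ ENNReal.ofReal η * (2 * μH[1] K) := by
  have := FiniteDimensional.of_fact_finrank_eq_two (K := ℝ) (V := V)
  have := FiniteDimensional.complete ℝ V
  have hη0 : 0 < η := one_pos.trans hη
  obtain ⟨F, hFK, hF, hFint, z, hsub⟩ :=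
    exists_finite_subset_homothety_image_convexHull hbdd hint hη
  let h := AffineMap.homothety z η
  calc μH[1] (frontier (convexHull ℝ K))
      ≤ μH[1] (frontier (h '' convexHull ℝ F)) :=
        hausdorffMeasure_frontier_mono_of_convex (convex_convexHull ℝ K) hint
          (convexHull_min hsub ((convex_convexHull ℝ F).affine_image h))
          ((hF.isCompact_convexHull ℝ).image (AffineMap.homothety_continuous z η)).isBounded
          zero_le_one
    _ = ENNReal.ofReal η * μH[1] (frontier (convexHull ℝ F)) := by
        rw [hausdorffMeasure_frontier_homothety_image zero_le_one z hη0.ne', NNReal.rpow_one,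
          ENNReal.smul_def, smul_eq_mul, ← enorm_eq_nnnorm, Real.enorm_eq_ofReal hη0.le]
    _ ≤ ENNReal.ofReal η * (2 * μH[1] K) := by
        gcongr
        exact hausdorffMeasure_frontier_convexHull_le_of_finite hF hFint hFK hK

theorem proposition2p9_general (hK : IsPreconnected K) :
    μH[1] (frontier (convexHull ℝ K)) ≤ 2 * μH[1] K := by
  rcases eq_or_ne (μH[1] K) ⊤ with htop | hfin
  · simp [htop]
  rcases (interior (convexHull ℝ K)).eq_empty_or_nonempty with hint | hint
  · exact (hausdorffMeasure_frontier_convexHull_le_of_interior_eq_empty hK hint).trans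
      (le_mul_of_one_le_left' one_le_two)
  have hbdd : Bornology.IsBounded K := isBounded_iff_ediam_ne_top.2
    (ne_top_of_le_ne_top hfin (ediam_le_hausdorffMeasure_of_isPreconnected hK))
  have hlim : Tendsto (fun η : ℝ => ENNReal.ofReal η * (2 * μH[1] K)) (𝓝[>] 1)
      (𝓝 (2 * μH[1] K)) := by
    have hofReal : Tendsto ENNReal.ofReal (𝓝[>] 1) (𝓝 1) := by
      simpa using (ENNReal.continuous_ofReal.tendsto 1).mono_left nhdsWithin_le_nhds
    simpa using ENNReal.Tendsto.mul_const (b := 2 * μH[1] K) hofReal (.inl one_ne_zero)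
  exact ge_of_tendsto hlim (eventually_mem_nhdsWithin.mono fun η hη =>
    hausdorffMeasure_frontier_convexHull_le_ofReal_mul hK hbdd hint hη)

end Plane

theorem proposition2p9 (K : Set (EuclideanSpace ℝ (Fin 2)))
    (hK_compact : IsCompact K) (hK_connected : IsPreconnected K)
    (hK_finite : μH[1] K < ⊤) :
    μH[1] (frontier (convexHull ℝ K)) ≤ 2 * μH[1] K := by
  have : Fact (finrank ℝ (EuclideanSpace ℝ (Fin 2)) = 2) := ⟨finrank_euclideanSpace_fin⟩
  exact proposition2p9_general hK_connected
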